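/- Write $x=(x_0,x_1,x_2,x_3)$ for points of $\mathbb R^4$, $S^3\subset\mathbb R^4$ for the unit sphere and $O(4,\mathbb R)$ for its isometry group. Products of transformations are compositions applied from right to left. **Coxeter group.** Let $W_s$ be the reflection in the hyperplane orthogonal to $a_s$, where $a_0=(1,0,0,0)$, $a_1=(0,0,0,1)$, $a_2=\sqrt{1/2}\,(0,0,-1,1)$, $a_3=\sqrt{1/2}\,(0,1,-1,0)$, $a_4=\sqrt{1/2}\,(-1,1,0,0)$. Let $G=\langle W_1,W_2,W_3,W_4\rangle$ (the Coxeter group of the 8-cell, with diagram $\circ\overset{4}{-}\circ\overset{3}{-}\circ\overset{3}{-}\circ$), and $\mathcal J_4x=-x$. **8-cell.** For $c\in\{\pm e_0,\pm e_1,\pm e_2,\pm e_3\}$ let $K_c=\{x\in S^3: |x_j|\le\langle c,x\rangle \text{ for all } j\}$. These eight spherical cubes form the 8-cell on $S^3$. The prototile is $K=K_{e_0}$. **The manifold $C3$.** $C3$ is the quotient space of $K$ obtained by gluing opposite faces with a $\pi/2$ twist: for each cyclic permutation $(j,k,l)$ of $(1,2,3)$, the point $x$ of the face $x_j=-x_0$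 is glued to the point $y$ of the face $y_j=y_0$ with $y_0=x_0$, $y_j=x_0$, $y_k=-x_l$, $y_l=x_k$. **Generators.** Let $q_1=(W_1W_2)(W_4W_0)\mathcal J_4$, $q_2=(W_3W_2)\,q_1\,(W_2W_3)$, $q_3=(W_2W_3)\,q_1\,(W_3W_2)$ and $Q=\langle q_1,q_2,q_3\rangle$. **Matrix coordinates.** Put $$u(x)=\begin{pmatrix} x_0-ix_3 & -x_2-ix_1\\ x_2-ix_1 & x_0+ix_3\end{pmatrix},$$ which identifies $S^3$ with $SU(2)$, and $v_s=u(a_s)$. Say that $g\in O(4,\mathbb R)$ acts as $T_{(w_l,w_r)}$ if $u(g^{-1}x)=w_l^{-1}u(x)w_r$ for all $x$ (that is, $(T_gf)(u)=f(w_l^{-1}uw_r)$ on functions). **Theorem.** 1. For every base point, $\pi_1(C3)$ is isomorphic to the quaternion group of order 8. 2. $S^3$ is simply connected, and there is a surjective covering map $p:S^3\to C3$, extending the quotient projection $K\to C3$, whose group of deck transformations is exactly the group of homeomorphisms of $S^3$ induced by $Q$. Both $Q$ and this deck group are isomorphic to the quaternion group of order 8. 3. For $j=1,2,3$, $q_j$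 maps the face $x_j=-x_0$ of $K$ into $K$, and its restriction to this face is the gluing described above. 4. $q_1^2=q_2^2=q_3^2=q_1q_2q_3=\mathcal J_4$ and $Q=\{e,q_1,q_2,q_3,\mathcal J_4,\mathcal J_4q_1,\mathcal J_4q_2,\mathcal J_4q_3\}$. 5. $Q$ acts by left multiplication only: $q_1=W_2W_1W_0W_4$ acts as $T_{(v_2v_1^{-1}v_0v_4^{-1},\;v_2^{-1}v_1v_0^{-1}v_4)}$; each $q_j$ acts as $T_{(w_{lj},e)}$ with $$w_{l1}=\begin{pmatrix}0&-i\\-i&0\end{pmatrix},\quad w_{l2}=\begin{pmatrix}0&-1\\1&0\end{pmatrix},\quad w_{l3}=\begin{pmatrix}-i&0\\0&i\end{pmatrix}$$ in $SU(2)$; and there is an injective homomorphism $\varphi:Q\to SU(2)$ with $u(gx)=\varphi(g)u(x)$ for all $g\in Q$ and $x$. 6. No element of $Q$ other than $e$ has a fixed point on $S^3$. 7. $g\mapsto gK$ is a bijection from $Q$ onto the set of the eight cubes of the 8-cell; the cubes $gK$, $g\in Q$, cover $S^3$, and distinct ones have disjoint interiors. 8. $O(4,\mathbb R)>G>Q$,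 with both inclusions proper. -/

import Mathlib

noncomputable section

namespace CubicSpherical

/-- Euclidean 4-space with coordinates `x 0, x 1, x 2, x 3`. -/
abbrev E4 : Type := EuclideanSpace ℝ (Fin 4)

/-- The unit sphere `S³` in `E4`. -/
abbrev S3 : Type := Metric.sphere (0 : E4) 1

/-- The orthogonal group `O(4,ℝ)`: linear isometries of `E4` under composition. -/
abbrev O4 : Type := E4 ≃ₗᵢ[ℝ] E4

/-- The action of `O(4,ℝ)` on `S³` by homeomorphisms. -/
def act : O4 →* (S3 ≃ₜ S3) where
  toFun g :=
    { toFun := fun x => ⟨g x, by simp⟩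
      invFun := fun x => ⟨g.symm x, by simp⟩
      left_inv := fun x => by simp
      right_inv := fun x => by simp
      continuous_toFun := by fun_prop
      continuous_invFun := by fun_prop }
  map_one' := by ext; rfl
  map_mul' _ _ := by ext; rfl

/-! ### The Coxeter group `G` with diagram `o -4- o -3- o -3- o` -/

/-- The Weyl vectors `a 1, a 2, a 3, a 4` and the additional vector `a 0`. -/
def weylVector : Fin 5 → E4 :=
  ![!₂[1, 0, 0, 0],
    !₂[0, 0, 0, 1],
    !₂[0, 0, -√(1 / 2), √(1 / 2)],
    !₂[0, √(1 / 2), -√(1 / 2), 0],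
    !₂[-√(1 / 2), √(1 / 2), 0, 0]]

/-- `W s` is the reflection of `E4` in the hyperplane orthogonal to the Weyl vector `a s`. -/
def W (s : Fin 5) : O4 := (Submodule.span ℝ {weylVector s})ᗮ.reflection

/-- The Coxeter group `G`, generated by the Weyl reflections `W 1, W 2, W 3, W 4`. -/
def G : Subgroup O4 := Subgroup.closure {W 1, W 2, W 3, W 4}

/-- The inversion `x ↦ -x` of `E4`. -/
def J4 : O4 := LinearIsometryEquiv.neg ℝ

/-! ### The 8-cell on `S³` and its cubic prototile -/

/-- The cell with center `c`; when `c` is one of the points `±e i`, this is the radial projection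
to `S³` of the facet of the hypercube `[-1,1]⁴` with center `c`. -/
def cell (c : E4) : Set S3 := {x | ∀ j : Fin 4, |(x : E4) j| ≤ inner ℝ c (x : E4)}

/-- The eight points `±e 0, ±e 1, ±e 2, ±e 3`. -/
def cellCenters : Set E4 :=
  {c | ∃ i : Fin 4, c = EuclideanSpace.single i 1 ∨ c = -EuclideanSpace.single i 1}

/-- The 8-cell on `S³`: the collection of its eight spherical cubes. -/
def eightCell : Set (Set S3) := cell '' cellCenters

/-- The cubic prototile, the spherical cube with center `(1,0,0,0)`. -/
def cube : Set S3 := cell (EuclideanSpace.single 0 1)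

/-! ### The manifold `C3` -/

/-- The three gluings of opposite faces of the cubic prototile. For `j = 0, 1, 2` the cyclically
ordered axes are `j+1`, `k`, `l` (a cyclic permutation of `1, 2, 3`). The face `x_{j+1} = -x_0` is
carried to the opposite face `x_{j+1} = x_0` and given a twist by `π/2` in the `(k,l)`-plane. -/
def GlueFace (j : Fin 3) (x y : cube) : Prop :=
  (x : E4) j.succ = -(x : E4) 0 ∧
  (y : E4) 0 = (x : E4) 0 ∧
  (y : E4) j.succ = (x : E4) 0 ∧
  (y : E4) (j + 1).succ = -(x : E4) (j + 2).succ ∧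
  (y : E4) (j + 2).succ = (x : E4) (j + 1).succ

/-- The manifold `C3`: the spherical cube with opposite faces glued, with the quotient topology
(`Quot` passes to the equivalence relation generated by the gluings). -/
abbrev C3 : Type := Quot (fun x y : cube => ∃ j, GlueFace j x y)

/-- The projection from the cubic prototile to `C3`. -/
def C3.mk (x : cube) : C3 := Quot.mk _ x

/-- The group of deck transformations of a map `p : X → B`. -/
def deck {X B : Type*} [TopologicalSpace X] (p : X → B) : Subgroup (X ≃ₜ X) where
  carrier := {f | ∀ x, p (f x) = p x}
  one_mem' _ := rfl
  mul_mem' {f g} hf hg x := (hf (g x)).trans (hg x)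
  inv_mem' {f} hf x := by
    have h := hf (f⁻¹ x)
    rw [← h]
    exact congrArg p (f.apply_symm_apply x)

/-! ### The glue generators and the group `Q` -/

/-- `q1`: the standard glue operator `W 4 * W 0 * J4` of the faces orthogonal to axis 1, followed
by the rotation `W 1 * W 2` by `-π/2` about axis 1. -/
def q1 : O4 := (W 1 * W 2) * (W 4 * W 0) * J4

def q2 : O4 := (W 3 * W 2) * q1 * (W 2 * W 3)

def q3 : O4 := (W 2 * W 3) * q1 * (W 3 * W 2)

/-- The three glue generators as a family. -/
def q : Fin 3 → O4 := ![q1, q2, q3]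

/-- The group generated by `q1, q2, q3`. -/
def Q : Subgroup O4 := Subgroup.closure {q1, q2, q3}

/-! ### The action of `SU(2) × SU(2)` by left and right multiplication -/

/-- The matrix coordinates `u` of a point `x`, with `z₁ = x₀ - i x₃` and `z₂ = -x₂ - i x₁`. It maps
`S³` bijectively to `SU(2)`. -/
def u (x : E4) : Matrix (Fin 2) (Fin 2) ℂ :=
  !![x 0 - Complex.I * x 3, -x 2 - Complex.I * x 1;
     x 2 - Complex.I * x 1, x 0 + Complex.I * x 3]

/-- The matrices `v s` of the Weyl vectors. -/
def v (s : Fin 5) : Matrix (Fin 2) (Fin 2) ℂ := u (weylVector s)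

/-- `T_{(wl,wr)}`: the operator `g` of `O(4,ℝ)` acts on functions on `S³` by
`(T_g f)(x) = f (g⁻¹ x)`, and in the matrix coordinates this substitutes `wl⁻¹ u wr` for `u`. -/
def ActsAs (g : O4) (wl wr : Matrix (Fin 2) (Fin 2) ℂ) : Prop :=
  ∀ x : E4, u (g⁻¹ x) = wl⁻¹ * u x * wr

/-- The matrices `-𝐤, -𝐣, -𝐢` of the standard quaternion representation. -/
def wLeft : Fin 3 → Matrix (Fin 2) (Fin 2) ℂ :=
  ![!![0, -Complex.I; -Complex.I, 0],
    !![0, -1; 1, 0],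
    !![-Complex.I, 0; 0, Complex.I]]

end CubicSpherical

end

open CubicSpherical

noncomputable section

namespace CubicSpherical

/-! Identify `S3` with the unit quaternions. In coordinates the reflections `W s` are sign changes
and transpositions, so `q1`, `q2`, `q3` are signed permutations, and they turn out to be left
multiplications by three anticommuting imaginary units. Thus `Q` consists of the eight left
multiplications by ±1 and ± these units; it acts freely, and an element is determined by the image
of e₀ (`apply_eq_of_mem_Q`). These images are exactly the points ±eᵢ (`image_Q_single_zero`), so the
translates of the cube are the eight cells.

The topological core is that `C3` is the orbit space of `Q`. Every orbit meets the cube, because the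
cells cover the sphere. Two points of the cube in one orbit are equal or glued by a single face
gluing (`eq_or_glueFace_of_act_eq`). Hence `C3` maps bijectively and continuously onto the orbit
space, and compactness makes this a homeomorphism (`homeoOrbits`).

A free action of a finite group on a Hausdorff space gives a covering. As the sphere is simply
connected (`simplyConnectedSpace_sphere`), both the deck group and the fundamental group are copies
of `Q`. Simple connectedness is proved by pushing a loop to a nearby C¹ loop, which misses a point
and so lies in a contractible set. -/

open QuaternionGroup in
/-- The homomorphism from the generalized quaternion group determined by two elements that satisfy
its defining relations. -/
def quaternionLift {M : Type*} [Group M] {n : ℕ} (a b : M) (ha : a ^ (2 * n) = 1)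
    (hb : b * b = a ^ n) (hab : b * a⁻¹ = a * b) : QuaternionGroup n →* M :=
  let E : ZMod (2 * n) →+ Additive M :=
    ZMod.lift (2 * n) ⟨zmultiplesHom (Additive M) (Additive.ofMul a), by
      rw [zmultiplesHom_apply, natCast_zsmul, ← ofMul_pow, ha, ofMul_one]⟩
  have hE (k : ℤ) : (E k).toMul = a ^ k := by simp [E]
  have hEb (i : ZMod (2 * n)) : b * (E (-i)).toMul = (E i).toMul * b := by
    obtain ⟨k, rfl⟩ := ZMod.intCast_surjective i
    have h : SemiconjBy b a⁻¹ a := hab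
    have := h.zpow_right k
    rw [← Int.cast_neg, hE, hE, ← inv_zpow']
    exact this
  { toFun := fun x => match x with
      | .a i => (E i).toMul
      | .xa i => b * (E i).toMul
    map_one' := by
      change (E 0).toMul = 1
      simp
    map_mul' := by
      rintro (i | i) (j | j)
      · simp [a_mul_a]
      · have : j - i = -i + j := by abel
        simp only [a_mul_xa, this, map_add, toMul_add, ← mul_assoc, hEb]
      · simp [xa_mul_a, mul_assoc]
      -- Moving the second b leftwards past aⁱ inverts that power, and b² = aⁿ supplies the summand
      -- n.
      · have h1 : (n : ZMod (2 * n)) + j - i = n + -i + j := by abel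
        have h2 : (E (n : ZMod (2 * n))).toMul = b * b := by
          rw [hb]; simpa using hE n
        simp only [xa_mul_xa, h1, map_add, toMul_add, h2]
        rw [mul_assoc b b, hEb]
        simp only [mul_assoc] }

@[simp] lemma quaternionLift_a_one {M : Type*} [Group M] {n : ℕ} (a b : M) (ha : a ^ (2 * n) = 1)
    (hb : b * b = a ^ n) (hab : b * a⁻¹ = a * b) :
    quaternionLift a b ha hb hab (.a 1) = a := by
  change Additive.toMul (ZMod.lift (A := Additive M) (2 * n) _ 1) = a
  rw [← Int.cast_one, ZMod.lift_coe]
  simp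

@[simp] lemma quaternionLift_xa_zero {M : Type*} [Group M] {n : ℕ} (a b : M)
    (ha : a ^ (2 * n) = 1) (hb : b * b = a ^ n) (hab : b * a⁻¹ = a * b) :
    quaternionLift a b ha hb hab (.xa 0) = b := by
  change b * Additive.toMul (ZMod.lift (A := Additive M) (2 * n) _ 0) = b
  simp

/-! ### Coordinate formulas -/

lemma norm_weylVector (s : Fin 5) : ‖weylVector s‖ = 1 := by
  have h : √(1 / 2 : ℝ) ^ 2 = 1 / 2 := Real.sq_sqrt (by norm_num)
  rw [EuclideanSpace.norm_eq, Real.sqrt_eq_one]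
  fin_cases s <;> simp [weylVector, Fin.sum_univ_four] <;> norm_num

lemma W_apply (s : Fin 5) (x : E4) :
    W s x = x - (2 * inner ℝ (weylVector s) x) • weylVector s := by
  rw [W, Submodule.reflection_orthogonal_apply, Submodule.reflection_singleton_apply,
    norm_weylVector]
  simp [mul_smul, two_smul]

@[simp] lemma W_zero_apply (x : E4) : W 0 x = !₂[-x 0, x 1, x 2, x 3] := by
  rw [W_apply]
  ext i
  fin_cases i <;> simp [weylVector, PiLp.inner_apply, Fin.sum_univ_four]
  ring

@[simp] lemma W_one_apply (x : E4) : W 1 x = !₂[x 0, x 1, x 2, -x 3] := by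
  rw [W_apply]
  ext i
  fin_cases i <;> simp [weylVector, PiLp.inner_apply, Fin.sum_univ_four]
  ring

@[simp] lemma W_two_apply (x : E4) : W 2 x = !₂[x 0, x 1, x 3, x 2] := by
  have h : (√2 : ℝ)⁻¹ ^ 2 = 1 / 2 := by rw [inv_pow, Real.sq_sqrt (by norm_num), one_div]
  rw [W_apply]
  ext i
  fin_cases i <;> simp [weylVector, PiLp.inner_apply, Fin.sum_univ_four] <;>
    first
      | linear_combination (2 * x 2 - 2 * x 3) * h
      | linear_combination (2 * x 3 - 2 * x 2) * h

@[simp] lemma W_three_apply (x : E4) : W 3 x = !₂[x 0, x 2, x 1, x 3] := by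
  have h : (√2 : ℝ)⁻¹ ^ 2 = 1 / 2 := by rw [inv_pow, Real.sq_sqrt (by norm_num), one_div]
  rw [W_apply]
  ext i
  fin_cases i <;> simp [weylVector, PiLp.inner_apply, Fin.sum_univ_four] <;>
    first
      | linear_combination (2 * x 1 - 2 * x 2) * h
      | linear_combination (2 * x 2 - 2 * x 1) * h

@[simp] lemma W_four_apply (x : E4) : W 4 x = !₂[x 1, x 0, x 2, x 3] := by
  have h : (√2 : ℝ)⁻¹ ^ 2 = 1 / 2 := by rw [inv_pow, Real.sq_sqrt (by norm_num), one_div]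
  rw [W_apply]
  ext i
  fin_cases i <;> simp [weylVector, PiLp.inner_apply, Fin.sum_univ_four] <;>
    first
      | linear_combination (2 * x 0 - 2 * x 1) * h
      | linear_combination (2 * x 1 - 2 * x 0) * h

@[simp] lemma J4_apply (x : E4) : J4 x = -x := rfl

@[simp] lemma q1_apply (x : E4) : q1 x = !₂[-x 1, x 0, -x 3, x 2] := by
  simp [q1]

@[simp] lemma q2_apply (x : E4) : q2 x = !₂[-x 2, x 3, x 0, -x 1] := by
  simp [q2]

@[simp] lemma q3_apply (x : E4) : q3 x = !₂[-x 3, -x 2, x 1, x 0] := by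
  simp [q3]

lemma q1_sq : q1 ^ 2 = J4 := by
  ext x i; fin_cases i <;> simp [pow_two]

lemma q2_sq : q2 ^ 2 = J4 := by
  ext x i; fin_cases i <;> simp [pow_two]

lemma q3_sq : q3 ^ 2 = J4 := by
  ext x i; fin_cases i <;> simp [pow_two]

lemma q1_mul_q2_mul_q3 : q1 * q2 * q3 = J4 := by
  ext x i; fin_cases i <;> simp

lemma J4_mul_J4 : J4 * J4 = 1 := by
  ext x i; simp

lemma q1_eq_W : q1 = W 2 * W 1 * W 0 * W 4 := by
  ext x i; fin_cases i <;> simp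

/-! ### The group `Q` -/

/-- The homomorphism from the quaternion group that maps the generators to `q1` and `q2`. -/
def quaternionHom : QuaternionGroup 2 →* O4 :=
  quaternionLift q1 q2
    (by rw [pow_mul, q1_sq, pow_two, J4_mul_J4])
    (by rw [← pow_two, q1_sq, q2_sq])
    (by rw [mul_inv_eq_iff_eq_mul]; ext x i; fin_cases i <;> simp)

@[simp] lemma quaternionHom_a_one : quaternionHom (.a 1) = q1 := quaternionLift_a_one ..

@[simp] lemma quaternionHom_xa_zero : quaternionHom (.xa 0) = q2 := quaternionLift_xa_zero ..

/-- The eight cases are words in the two generators, so that a homomorphism can be evaluated on each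
of them by `map_mul`. -/
lemma forall_quaternionGroup_two {P : QuaternionGroup 2 → Prop} (h1 : P 1) (ha : P (.a 1))
    (hb : P (.xa 0)) (hab : P (.a 1 * .xa 0)) (hz : P (.a 1 * .a 1))
    (hza : P (.a 1 * .a 1 * .a 1)) (hzb : P (.a 1 * .a 1 * .xa 0))
    (hzab : P (.a 1 * .a 1 * (.a 1 * .xa 0))) (g : QuaternionGroup 2) : P g := by
  have h : ∀ g : QuaternionGroup 2, g = 1 ∨ g = .a 1 ∨ g = .xa 0 ∨ g = .a 1 * .xa 0 ∨
      g = .a 1 * .a 1 ∨ g = .a 1 * .a 1 * .a 1 ∨ g = .a 1 * .a 1 * .xa 0 ∨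
      g = .a 1 * .a 1 * (.a 1 * .xa 0) := by decide
  rcases h g with rfl | rfl | rfl | rfl | rfl | rfl | rfl | rfl <;> assumption

lemma q1_mul_q1 : q1 * q1 = J4 := by rw [← pow_two, q1_sq]

lemma q1_mul_q2 : q1 * q2 = q3 := by
  ext x i; fin_cases i <;> simp

lemma q2_mul_q3 : q2 * q3 = q1 := by
  ext x i; fin_cases i <;> simp

lemma J4_mul_J4_mul (g : O4) : J4 * (J4 * g) = g := by
  rw [← mul_assoc, J4_mul_J4, one_mul]

lemma range_quaternionHom : quaternionHom.range = Q := by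
  have h1 : q1 ∈ quaternionHom.range := ⟨_, quaternionHom_a_one⟩
  have h2 : q2 ∈ quaternionHom.range := ⟨_, quaternionHom_xa_zero⟩
  have h3 : q3 = q2⁻¹ * q1 := by rw [← q2_mul_q3, inv_mul_cancel_left]
  have hQ1 : q1 ∈ Q := Subgroup.subset_closure (by simp)
  have hQ2 : q2 ∈ Q := Subgroup.subset_closure (by simp)
  apply le_antisymm
  · rintro _ ⟨g, rfl⟩
    induction g using forall_quaternionGroup_two <;>
      simp only [map_mul, map_one, quaternionHom_a_one, quaternionHom_xa_zero] <;>
      simp only [one_mem, mul_mem, hQ1, hQ2]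
  · rw [Q, Subgroup.closure_le]
    rintro g (rfl | rfl | rfl)
    · exact h1
    · exact h2
    · rw [h3]
      exact mul_mem (inv_mem h2) h1

/-- The elements of `Q`. -/
lemma coe_Q : (Q : Set O4) = {1, q1, q2, q3, J4, J4 * q1, J4 * q2, J4 * q3} := by
  rw [← range_quaternionHom]
  ext g
  constructor
  · rintro ⟨g, rfl⟩
    induction g using forall_quaternionGroup_two <;>
      simp only [map_mul, map_one, quaternionHom_a_one, quaternionHom_xa_zero, q1_mul_q1,
        q1_mul_q2] <;> simp
  · rw [range_quaternionHom]
    have h1 : q1 ∈ Q := Subgroup.subset_closure (by simp)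
    have h2 : q2 ∈ Q := Subgroup.subset_closure (by simp)
    have h3 : q3 ∈ Q := Subgroup.subset_closure (by simp)
    have hJ : J4 ∈ Q := q1_mul_q1 ▸ mul_mem h1 h1
    rintro (rfl | rfl | rfl | rfl | rfl | rfl | rfl | rfl) <;>
      simp only [SetLike.mem_coe, one_mem, mul_mem, *]

/-- Case distinction over the elements of `Q`. -/
lemma forall_mem_Q {P : O4 → Prop} :
    (∀ g ∈ Q, P g) ↔ P 1 ∧ P q1 ∧ P q2 ∧ P q3 ∧ P J4 ∧ P (J4 * q1) ∧ P (J4 * q2) ∧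
      P (J4 * q3) := by
  simp only [← SetLike.mem_coe, coe_Q, Set.forall_mem_insert, Set.mem_singleton_iff, forall_eq]

/-- `Q` acts by quaternionic multiplication: an element is determined by the image of the base
point `(1,0,0,0)`. -/
lemma apply_eq_of_mem_Q {g : O4} (hg : g ∈ Q) {y : E4} (hy : g (EuclideanSpace.single 0 1) = y)
    (x : E4) : g x = !₂[y 0 * x 0 - y 1 * x 1 - y 2 * x 2 - y 3 * x 3,
      y 1 * x 0 + y 0 * x 1 - y 3 * x 2 + y 2 * x 3,
      y 2 * x 0 + y 3 * x 1 + y 0 * x 2 - y 1 * x 3,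
      y 3 * x 0 - y 2 * x 1 + y 1 * x 2 + y 0 * x 3] := by
  subst hy
  revert g
  rw [forall_mem_Q]
  refine ⟨?_, ?_, ?_, ?_, ?_, ?_, ?_, ?_⟩ <;> ext i <;> fin_cases i <;> simp

lemma eq_of_mem_Q {g h : O4} (hg : g ∈ Q) (hh : h ∈ Q)
    (hgh : g (EuclideanSpace.single 0 1) = h (EuclideanSpace.single 0 1)) : g = h := by
  ext1 x
  exact (apply_eq_of_mem_Q hg hgh x).trans (apply_eq_of_mem_Q hh rfl x).symm

lemma eq_zero_of_neg_eq_self {x : E4} (h : -x = x) : x = 0 := by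
  ext i
  have : -x i = x i := congrArg (fun v : E4 => v i) h
  simp only [PiLp.zero_apply]
  linarith

/-- `Q` acts freely on the nonzero vectors. -/
lemma eq_one_of_apply_eq {g : O4} (hg : g ∈ Q) {x : E4} (hx : x ≠ 0) (h : g x = x) : g = 1 := by
  revert g
  rw [forall_mem_Q]
  -- All elements other than ±1 square to -1, so a vector fixed by one of them satisfies -x = x.
  have key : ∀ g : O4, g * g = J4 → g x = x → g = 1 := by
    intro g hg h
    have h1 : (g * g) x = x := by simp [h]
    rw [hg] at h1
    exact absurd (eq_zero_of_neg_eq_self h1) hx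
  have hJ : ∀ g : O4, J4 * g = g * J4 := fun g => by ext1 x; simp
  have h1 : ∀ g : O4, g * g = J4 → J4 * g * (J4 * g) = J4 := fun g hg => by
    rw [mul_assoc, ← mul_assoc g, ← hJ g, mul_assoc, J4_mul_J4_mul, hg]
  refine ⟨fun _ => rfl, key _ q1_mul_q1, key _ (pow_two q2 ▸ q2_sq), key _ (pow_two q3 ▸ q3_sq),
    fun h => ?_, key _ (h1 _ q1_mul_q1), key _ (h1 _ (pow_two q2 ▸ q2_sq)),
    key _ (h1 _ (pow_two q3 ▸ q3_sq))⟩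
  exact absurd (eq_zero_of_neg_eq_self h) hx

lemma quaternionHom_injective : Function.Injective quaternionHom := by
  rw [injective_iff_map_eq_one]
  intro g
  induction g using forall_quaternionGroup_two
  · simp
  all_goals
    intro h
    simp only [map_mul, quaternionHom_a_one, quaternionHom_xa_zero] at h
    have h := DFunLike.congr_fun h (EuclideanSpace.single 0 1)
    -- A nontrivial word sends e₀ to some ±eᵢ other than e₀, whose coordinate 0 is 0 or -1.
    have h0 : _ = (1 : ℝ) := congrArg (fun v : E4 => v 0) h
    simp [-Fin.isValue] at h0
    try norm_num at h0

/-- `Q` is a quaternion group of order eight. -/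
def quaternionEquivQ : QuaternionGroup 2 ≃* Q :=
  (MonoidHom.ofInjective quaternionHom_injective).trans
    (MulEquiv.subgroupCongr range_quaternionHom)

/-! ### Matrix coordinates -/

lemma sum_sq_eq_norm_sq (x : E4) : x 0 ^ 2 + x 1 ^ 2 + x 2 ^ 2 + x 3 ^ 2 = ‖x‖ ^ 2 := by
  rw [EuclideanSpace.real_norm_sq_eq, Fin.sum_univ_four]

lemma det_u (x : E4) : (u x).det = (‖x‖ : ℂ) ^ 2 := by
  rw [← Complex.ofReal_pow, ← sum_sq_eq_norm_sq, u, Matrix.det_fin_two_of]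
  push_cast
  linear_combination (-(x 3 : ℂ) ^ 2 - (x 1 : ℂ) ^ 2) * Complex.I_sq

lemma u_mem_specialUnitaryGroup {x : E4} (hx : ‖x‖ = 1) :
    u x ∈ Matrix.specialUnitaryGroup (Fin 2) ℂ := by
  have h : (x 0 : ℂ) ^ 2 + (x 1 : ℂ) ^ 2 + (x 2 : ℂ) ^ 2 + (x 3 : ℂ) ^ 2 = 1 := by
    exact_mod_cast (sum_sq_eq_norm_sq x).trans (by rw [hx, one_pow])
  rw [Matrix.mem_specialUnitaryGroup_iff, Matrix.mem_unitaryGroup_iff, det_u, hx]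
  refine ⟨?_, by simp⟩
  ext i j
  fin_cases i <;> fin_cases j <;>
    simp [u, Matrix.mul_apply, Matrix.star_apply, Fin.sum_univ_two, -Complex.coe_algebraMap]
  · linear_combination h - ((x 3 : ℂ) ^ 2 + (x 1 : ℂ) ^ 2) * Complex.I_sq
  · ring
  · ring
  · linear_combination h - ((x 3 : ℂ) ^ 2 + (x 1 : ℂ) ^ 2) * Complex.I_sq

lemma u_injective : Function.Injective u := by
  intro x y h
  have h00 := congrFun (congrFun h 0) 0
  have h10 := congrFun (congrFun h 1) 0
  simp [u, Complex.ext_iff] at h00 h10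
  ext i
  fin_cases i <;> simp [*]

lemma u_single_zero : u (EuclideanSpace.single 0 1) = 1 := by
  ext i j
  fin_cases i <;> fin_cases j <;> simp [u]

/-- `Q` acts by left multiplication. -/
lemma u_apply_of_mem_Q {g : O4} (hg : g ∈ Q) (x : E4) :
    u (g x) = u (g (EuclideanSpace.single 0 1)) * u x := by
  rw [apply_eq_of_mem_Q hg rfl x]
  generalize g (EuclideanSpace.single 0 1) = y
  ext i j
  fin_cases i <;> fin_cases j <;> simp [u, Matrix.mul_apply, Fin.sum_univ_two]
  all_goals ring_nf; simp only [Complex.I_sq]; ring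

lemma norm_apply_single_zero (g : O4) : ‖g (EuclideanSpace.single 0 1)‖ = 1 := by simp

lemma actsAs_of_mem_Q {g : O4} (hg : g ∈ Q) :
    ActsAs g (u (g (EuclideanSpace.single 0 1))) 1 := by
  intro x
  have hdet : IsUnit (u (g (EuclideanSpace.single 0 1))).det := by simp [det_u]
  have h := u_apply_of_mem_Q hg (g⁻¹ x)
  rw [show g (g⁻¹ x) = x from g.apply_symm_apply x] at h
  rw [h, mul_one, Matrix.nonsing_inv_mul_cancel_left _ _ hdet]

lemma q_mem_Q (j : Fin 3) : q j ∈ Q := by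
  apply Subgroup.subset_closure
  fin_cases j <;> simp [q]

lemma u_q_single_zero (j : Fin 3) : u (q j (EuclideanSpace.single 0 1)) = wLeft j := by
  fin_cases j <;> ext i k <;> fin_cases i <;> fin_cases k <;> simp [q, u, wLeft]

lemma wLeft_mem_specialUnitaryGroup (j : Fin 3) :
    wLeft j ∈ Matrix.specialUnitaryGroup (Fin 2) ℂ := by
  rw [← u_q_single_zero]
  exact u_mem_specialUnitaryGroup (norm_apply_single_zero _)

lemma actsAs_q (j : Fin 3) : ActsAs (q j) (wLeft j) 1 := by
  rw [← u_q_single_zero]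
  exact actsAs_of_mem_Q (q_mem_Q j)

lemma v_inv (s : Fin 5) : (v s)⁻¹ = star (v s) := by
  apply Matrix.inv_eq_right_inv
  exact (Matrix.mem_unitaryGroup_iff).1
    (Matrix.mem_specialUnitaryGroup_iff.1 (u_mem_specialUnitaryGroup (norm_weylVector s))).1

lemma sqrt_half_mul_self : ((√2 : ℝ) : ℂ)⁻¹ * ((√2 : ℝ) : ℂ)⁻¹ = 1 / 2 := by
  rw [← mul_inv, ← Complex.ofReal_mul, Real.mul_self_sqrt (by norm_num)]
  simp

lemma star_u (x : E4) : star (u x) =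
    !![x 0 + Complex.I * x 3, x 2 + Complex.I * x 1;
      -x 2 + Complex.I * x 1, x 0 - Complex.I * x 3] := by
  ext i j
  fin_cases i <;> fin_cases j <;> simp [u, Matrix.star_apply, sub_eq_add_neg]

lemma leftFactor_eq : v 2 * (v 1)⁻¹ * v 0 * (v 4)⁻¹ = -wLeft 0 := by
  have h := sqrt_half_mul_self
  have hI := Complex.I_sq
  simp only [v_inv]
  simp only [v, star_u]
  ext i j
  fin_cases i <;> fin_cases j <;>
    simp [u, weylVector, wLeft, Matrix.mul_apply, Fin.sum_univ_two] <;> grind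

lemma rightFactor_eq : (v 2)⁻¹ * v 1 * (v 0)⁻¹ * v 4 = -1 := by
  have h := sqrt_half_mul_self
  have hI := Complex.I_sq
  simp only [v_inv]
  simp only [v, star_u]
  ext i j
  fin_cases i <;> fin_cases j <;>
    simp [u, weylVector, Matrix.mul_apply, Fin.sum_univ_two] <;> grind

/-- The products of the Weyl matrices give the pair (-w, -1) with w = `wLeft 0`; the two signs
cancel, so it acts as (w, 1). -/
lemma actsAs_q1 : ActsAs q1 (v 2 * (v 1)⁻¹ * v 0 * (v 4)⁻¹) ((v 2)⁻¹ * v 1 * (v 0)⁻¹ * v 4) := by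
  intro x
  have hdet : (wLeft 0).det = 1 :=
    (Matrix.mem_specialUnitaryGroup_iff.1 (wLeft_mem_specialUnitaryGroup 0)).2
  have hinv : (-wLeft 0)⁻¹ = -(wLeft 0)⁻¹ := by
    apply Matrix.inv_eq_right_inv
    rw [neg_mul_neg, Matrix.mul_nonsing_inv _ (by simp [hdet])]
  rw [leftFactor_eq, rightFactor_eq, hinv]
  simpa [q] using actsAs_q 0 x

/-- The embedding of `Q` in `SU(2)`. -/
def toSU : Q →* Matrix.specialUnitaryGroup (Fin 2) ℂ where
  toFun g := ⟨u ((g : O4) (EuclideanSpace.single 0 1)),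
    u_mem_specialUnitaryGroup (norm_apply_single_zero _)⟩
  map_one' := Subtype.ext u_single_zero
  map_mul' g _ := Subtype.ext (u_apply_of_mem_Q g.2 _)

lemma toSU_injective : Function.Injective toSU := fun g h hgh =>
  Subtype.ext (eq_of_mem_Q g.2 h.2 (u_injective (congrArg Subtype.val hgh)))

/-! ### The chain of groups -/

lemma W_mem_G {s : Fin 5} (hs : s ≠ 0) : W s ∈ G := by
  apply Subgroup.subset_closure
  fin_cases s <;> simp at hs ⊢

lemma W_zero_mem_G : W 0 ∈ G := by
  -- `W 1` changes the sign of coordinate 3; conjugation by the transpositions moves this coordinate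
  -- to position 0.
  have h : W 0 = W 4 * (W 3 * (W 2 * (W 1 * (W 2 * (W 3 * W 4))))) := by
    ext x i; fin_cases i <;> simp
  have h1 : W 1 ∈ G := W_mem_G (by decide)
  have h2 : W 2 ∈ G := W_mem_G (by decide)
  have h3 : W 3 ∈ G := W_mem_G (by decide)
  have h4 : W 4 ∈ G := W_mem_G (by decide)
  exact h ▸ mul_mem h4 (mul_mem h3 (mul_mem h2 (mul_mem h1 (mul_mem h2 (mul_mem h3 h4)))))

lemma Q_le_G : Q ≤ G := by
  have h1 : W 1 ∈ G := W_mem_G (by decide)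
  have h2 : W 2 ∈ G := W_mem_G (by decide)
  have h3 : W 3 ∈ G := W_mem_G (by decide)
  have h4 : W 4 ∈ G := W_mem_G (by decide)
  have hq1 : q1 ∈ G := q1_eq_W ▸ mul_mem (mul_mem (mul_mem h2 h1) W_zero_mem_G) h4
  rw [Q, Subgroup.closure_le]
  rintro g (rfl | rfl | rfl)
  · exact hq1
  · exact mul_mem (mul_mem (mul_mem h3 h2) hq1) (mul_mem h2 h3)
  · exact mul_mem (mul_mem (mul_mem h2 h3) hq1) (mul_mem h3 h2)

/-- `W 1` is a nontrivial element of `G` that fixes e₀, whereas `Q` acts freely. -/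
lemma Q_lt_G : Q < G := by
  refine lt_of_le_of_ne Q_le_G fun h => ?_
  have h1 : W 1 ∈ Q := h ▸ W_mem_G (by decide)
  have h2 : W 1 = 1 := by
    apply eq_one_of_apply_eq h1 (x := EuclideanSpace.single 0 1) (by simp)
    ext i; fin_cases i <;> simp
  have h3 := congrArg (fun g : O4 => g (EuclideanSpace.single 3 1) 3) h2
  simp at h3
  norm_num at h3

/-- The Coxeter group of the 8-cell preserves a quartic form. -/
lemma sum_pow_four_of_mem_G {g : O4} (hg : g ∈ G) (x : E4) :
    ∑ i, g x i ^ 4 = ∑ i, x i ^ 4 := by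
  revert x
  induction hg using Subgroup.closure_induction with
  | mem g hg =>
    intro x
    rcases hg with rfl | rfl | rfl | rfl <;> simp [Fin.sum_univ_four] <;> ring
  | one => simp
  | mul a b _ _ ha hb => exact fun x => (ha (b x)).trans (hb x)
  | inv a _ ha =>
    intro x
    rw [← ha, show a (a⁻¹ x) = x from a.apply_symm_apply x]

/-- The reflection exchanging e₀ and (½,½,½,½) changes the sum of fourth powers from 1 to 1/4. -/
lemma G_lt_top : G < ⊤ := by
  refine lt_top_iff_ne_top.2 fun h => ?_
  let a : E4 := EuclideanSpace.single 0 1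
  let b : E4 := !₂[1 / 2, 1 / 2, 1 / 2, 1 / 2]
  have hb : ‖b‖ = 1 := by
    rw [← sq_eq_sq₀ (norm_nonneg _) zero_le_one, ← sum_sq_eq_norm_sq]
    simp [b]
    norm_num
  have hab : ‖a‖ = ‖b‖ := by rw [hb]; simp [a]
  have h1 := sum_pow_four_of_mem_G (h ▸ Subgroup.mem_top (Submodule.reflection (ℝ ∙ (a - b))ᗮ)) a
  rw [Submodule.reflection_sub hab] at h1
  simp [a, b, Fin.sum_univ_four] at h1
  norm_num at h1

/-! ### The tiling by the eight cubes -/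

@[simp] lemma coe_act (g : O4) (x : S3) : (act g x : E4) = g x := rfl

lemma act_inv_apply_act (g : O4) (x : S3) : act g⁻¹ (act g x) = x :=
  Subtype.ext (g.symm_apply_apply x)

lemma act_act_inv_apply (g : O4) (x : S3) : act g (act g⁻¹ x) = x :=
  Subtype.ext (g.apply_symm_apply x)

/-- Elements of `Q` only permute coordinates and change signs. -/
lemma forall_abs_apply_le_iff {g : O4} (hg : g ∈ Q) (x : E4) (t : ℝ) :
    (∀ j, |g x j| ≤ t) ↔ ∀ j, |x j| ≤ t := by
  revert g
  rw [forall_mem_Q]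
  refine ⟨?_, ?_, ?_, ?_, ?_, ?_, ?_, ?_⟩ <;> simp [Fin.forall_fin_succ] <;> tauto

lemma act_apply_mem_cell {g : O4} (hg : g ∈ Q) {c : E4} {x : S3} :
    act g x ∈ cell (g c) ↔ x ∈ cell c := by
  simpa only [cell, Set.mem_ofPred_eq, coe_act, LinearIsometryEquiv.inner_map_map] using
    forall_abs_apply_le_iff hg x (inner ℝ c (x : E4))

lemma act_image_cell {g : O4} (hg : g ∈ Q) (c : E4) : act g '' cell c = cell (g c) := by
  ext y
  constructor
  · rintro ⟨x, hx, rfl⟩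
    exact (act_apply_mem_cell hg).2 hx
  · intro hy
    refine ⟨act g⁻¹ y, ?_, act_act_inv_apply g y⟩
    rwa [← act_apply_mem_cell hg, act_act_inv_apply]

lemma act_image_cube {g : O4} (hg : g ∈ Q) :
    act g '' cube = cell (g (EuclideanSpace.single 0 1)) :=
  act_image_cell hg _

lemma image_Q_single_zero :
    (fun g : O4 => g (EuclideanSpace.single 0 1)) '' Q = cellCenters := by
  have e0 : (EuclideanSpace.single 0 1 : E4) = !₂[1, 0, 0, 0] := by
    ext i; fin_cases i <;> simp
  have e1 : (EuclideanSpace.single 1 1 : E4) = !₂[0, 1, 0, 0] := by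
    ext i; fin_cases i <;> simp
  have e2 : (EuclideanSpace.single 2 1 : E4) = !₂[0, 0, 1, 0] := by
    ext i; fin_cases i <;> simp
  have e3 : (EuclideanSpace.single 3 1 : E4) = !₂[0, 0, 0, 1] := by
    ext i; fin_cases i <;> simp
  rw [coe_Q]
  simp only [Set.image_insert_eq, Set.image_singleton, cellCenters, Fin.exists_fin_succ,
    Fin.exists_fin_zero]
  simp [e0, e1, e2, e3]
  ext c
  simp
  tauto

lemma norm_of_mem_cellCenters {c : E4} (hc : c ∈ cellCenters) : ‖c‖ = 1 := by
  obtain ⟨i, rfl | rfl⟩ := hc <;> simp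

/-- A cube is the set of points of the sphere at which its center attains the maximal inner
product. -/
lemma inner_le_of_mem_cell {c d : E4} {x : S3} (hx : x ∈ cell c) (hd : d ∈ cellCenters) :
    inner ℝ d (x : E4) ≤ inner ℝ c (x : E4) := by
  obtain ⟨i, rfl | rfl⟩ := hd
  · simpa [EuclideanSpace.inner_single_left] using (le_abs_self _).trans (hx i)
  · simpa [EuclideanSpace.inner_single_left] using (neg_le_abs _).trans (hx i)

lemma mem_cell_self {c : E4} (hc : c ∈ cellCenters) (h : ‖c‖ = 1) :
    (⟨c, by simpa using h⟩ : S3) ∈ cell c := by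
  intro j
  simp only [real_inner_self_eq_norm_sq, h]
  obtain ⟨i, rfl | rfl⟩ := hc <;> simp <;> split_ifs <;> simp

/-- Each center lies in its own cell. If the cells of c and d agree, then 1 = ⟨c,c⟩ ≤ ⟨d,c⟩, and
equality in Cauchy–Schwarz gives c = d. -/
lemma cell_injOn : Set.InjOn cell cellCenters := by
  intro c hc d hd h
  have h1 := norm_of_mem_cellCenters hc
  have h2 := norm_of_mem_cellCenters hd
  have h3 := inner_le_of_mem_cell (h ▸ mem_cell_self hc h1) hc
  simp only [real_inner_self_eq_norm_sq, h1] at h3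
  exact ((inner_eq_one_iff_of_norm_eq_one h2 h1).1
    (le_antisymm ((real_inner_le_norm _ _).trans (by simp [h1, h2])) (by simpa using h3))).symm

lemma bijOn_act_image_cube : Set.BijOn (fun g : O4 => act g '' cube) Q eightCell := by
  refine ⟨fun g hg => ?_, fun g hg h hh hgh => ?_, ?_⟩
  · simp only [act_image_cube hg]
    exact Set.mem_image_of_mem _ (image_Q_single_zero ▸ Set.mem_image_of_mem _ hg)
  · simp only [act_image_cube hg, act_image_cube hh] at hgh
    exact eq_of_mem_Q hg hh (cell_injOn (image_Q_single_zero ▸ Set.mem_image_of_mem _ hg)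
      (image_Q_single_zero ▸ Set.mem_image_of_mem _ hh) hgh)
  · rintro _ ⟨c, hc, rfl⟩
    rw [← image_Q_single_zero] at hc
    obtain ⟨g, hg, rfl⟩ := hc
    exact ⟨g, hg, act_image_cube hg⟩

lemma exists_mem_cell (x : S3) : ∃ c ∈ cellCenters, x ∈ cell c := by
  obtain ⟨i, hi⟩ := Finite.exists_max fun j => |(x : E4) j|
  rcases abs_cases ((x : E4) i) with h | h
  · exact ⟨EuclideanSpace.single i 1, ⟨i, .inl rfl⟩, fun j => by simpa [h.1, EuclideanSpace.inner_single_left] using hi j⟩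
  · exact ⟨-EuclideanSpace.single i 1, ⟨i, .inr rfl⟩, fun j => by simpa [h.1, EuclideanSpace.inner_single_left] using hi j⟩

lemma exists_act_mem_cube (x : S3) : ∃ g ∈ Q, act g x ∈ cube := by
  obtain ⟨c, hc, hx⟩ := exists_mem_cell x
  rw [← image_Q_single_zero] at hc
  obtain ⟨g, hg, rfl⟩ := hc
  refine ⟨g⁻¹, inv_mem hg, ?_⟩
  rwa [cube, ← act_apply_mem_cell hg, act_act_inv_apply]

lemma iUnion_act_image_cube : (⋃ g ∈ Q, act g '' cube) = Set.univ := by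
  refine Set.eq_univ_of_forall fun x => ?_
  obtain ⟨g, hg, hx⟩ := exists_act_mem_cube x
  exact Set.mem_biUnion (inv_mem hg) ⟨_, hx, act_inv_apply_act g x⟩

/-- Common points of two cells lie in the hyperplane orthogonal to c - d. From an interior common
point, the curve `γ` moves in the direction c - d, stays in both cells for small t, and yet leaves
that hyperplane at once. -/
lemma disjoint_interior_cell {c d : E4} (hc : c ∈ cellCenters) (hd : d ∈ cellCenters)
    (hcd : c ≠ d) : Disjoint (interior (cell c)) (interior (cell d)) := by
  rw [Set.disjoint_iff_inter_eq_empty, ← interior_inter, Set.eq_empty_iff_forall_notMem]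
  intro x hx
  have horth {y : S3} (hy : y ∈ cell c ∩ cell d) : inner ℝ (c - d) (y : E4) = 0 := by
    rw [inner_sub_left, sub_eq_zero]
    exact le_antisymm (inner_le_of_mem_cell hy.2 hc) (inner_le_of_mem_cell hy.1 hd)
  have hne (t : ℝ) : (x : E4) + t • (c - d) ≠ 0 := by
    intro h
    have h1 := congrArg (inner ℝ (x : E4)) h
    rw [inner_add_right, inner_smul_right, real_inner_comm (c - d), horth (interior_subset hx)] at h1
    simp at h1
  let γ : ℝ → S3 := fun t => ⟨‖(x : E4) + t • (c - d)‖⁻¹ • ((x : E4) + t • (c - d)), by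
    rw [mem_sphere_zero_iff_norm, norm_smul]
    simp [inv_mul_cancel₀ (norm_ne_zero_iff.2 (hne t))]⟩
  have hγ : Continuous γ := by
    refine Continuous.subtype_mk ?_ _
    have h1 : Continuous fun t : ℝ => (x : E4) + t • (c - d) := by fun_prop
    exact (h1.norm.inv₀ fun t => norm_ne_zero_iff.2 (hne t)).smul h1
  have hγ0 : γ 0 = x := by ext1; simp [γ]
  have h1 : ∀ᶠ t in nhds (0 : ℝ), γ t ∈ cell c ∩ cell d :=
    hγ.continuousAt.eventually_mem (hγ0.symm ▸ mem_interior_iff_mem_nhds.1 hx)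
  obtain ⟨t, ht, ht0⟩ := ((h1.filter_mono nhdsWithin_le_nhds).and
    (self_mem_nhdsWithin : {0}ᶜ ∈ nhdsWithin (0 : ℝ) {0}ᶜ)).exists
  have h2 := horth ht
  simp only [γ, inner_smul_right, inner_add_right, horth (interior_subset hx), zero_add,
    real_inner_self_eq_norm_sq] at h2
  have h3 := norm_ne_zero_iff.2 (hne t)
  have h4 := norm_ne_zero_iff.2 (sub_ne_zero.2 hcd)
  simp_all

/-! ### The gluings -/

lemma glueFace_iff (j : Fin 3) (x y : cube) :
    GlueFace j x y ↔ (x : E4) j.succ = -(x : E4) 0 ∧ (y : E4) = q j x := by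
  obtain ⟨x, hx⟩ := x
  obtain ⟨y, hy⟩ := y
  have h : ∀ z w : E4, z = w ↔ z 0 = w 0 ∧ z 1 = w 1 ∧ z 2 = w 2 ∧ z 3 = w 3 := by
    intro z w
    rw [PiLp.ext_iff]
    simp [Fin.forall_fin_succ]
  rw [h]
  fin_cases j <;> simp [GlueFace, q] <;> grind

lemma mem_cube_iff {x : S3} : x ∈ cube ↔ ∀ j, |(x : E4) j| ≤ (x : E4) 0 := by
  simp [cube, cell, EuclideanSpace.inner_single_left]

lemma act_q_mem_cube (j : Fin 3) (x : cube) (h : (x : E4) j.succ = -(x : E4) 0) :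
    act (q j) x ∈ cube := by
  obtain ⟨x, hx⟩ := x
  rw [mem_cube_iff] at hx ⊢
  simp only [coe_act, forall_abs_apply_le_iff (q_mem_Q j)]
  have : q j x 0 = (x : E4) 0 := by
    fin_cases j <;> simp [q] at h ⊢ <;> linarith
  rwa [this]

/-- With j running over the axes 1, 2, 3, here y₀ = -xⱼ and yⱼ = x₀. The cube inequalities -xⱼ ≤ x₀
and yⱼ ≤ y₀ then force x onto the face xⱼ = -x₀. -/
lemma glueFace_of_eq_q_apply {j : Fin 3} {x y : cube} (h : (y : E4) = q j x) :
    GlueFace j x y := by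
  refine (glueFace_iff j x y).2 ⟨?_, h⟩
  have h1 := (abs_le.1 (mem_cube_iff.1 x.2 j.succ)).1
  have h2 := (abs_le.1 (mem_cube_iff.1 y.2 j.succ)).2
  have h3 : (y : E4) 0 = -(x : E4) j.succ ∧ (y : E4) j.succ = (x : E4) 0 := by
    rw [h]
    fin_cases j <;> simp [q]
  linarith [h3.1, h3.2]

/-- Two points of the prototile in the same `Q`-orbit are equal or glued. -/
lemma eq_or_glueFace_of_act_eq {g : O4} (hg : g ∈ Q) {x y : cube}
    (h : (y : E4) = g x) : x = y ∨ ∃ j, GlueFace j x y ∨ GlueFace j y x := by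
  -- Since -`q j` is the inverse of `q j`, these cases are the gluings with x and y exchanged.
  have hneg {j : Fin 3} (hj : (y : E4) = -q j x) : (x : E4) = q j y := by
    have hsq : q j * q j = J4 := by
      rw [← pow_two]
      fin_cases j
      exacts [q1_sq, q2_sq, q3_sq]
    have h1 : q j (q j x) = -(x : E4) := DFunLike.congr_fun hsq (x : E4)
    rw [hj, map_neg, h1, neg_neg]
  revert g
  rw [forall_mem_Q]
  refine ⟨fun h => ?_, fun h => ?_, fun h => ?_, fun h => ?_, fun h => ?_, fun h => ?_,
    fun h => ?_, fun h => ?_⟩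
  · exact .inl (Subtype.ext (Subtype.ext h.symm))
  · exact .inr ⟨0, .inl (glueFace_of_eq_q_apply h)⟩
  · exact .inr ⟨1, .inl (glueFace_of_eq_q_apply h)⟩
  · exact .inr ⟨2, .inl (glueFace_of_eq_q_apply h)⟩
  -- Antipodal points cannot both lie in the cube: x₀ would be 0, and x₀ bounds all coordinates.
  · have hx := mem_cube_iff.1 x.2
    have hx0 := (abs_nonneg _).trans (hx 0)
    have hy0 := (abs_nonneg _).trans (mem_cube_iff.1 y.2 0)
    rw [h, J4_apply, PiLp.neg_apply] at hy0
    have h1 : (x : E4) = 0 := by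
      ext j
      exact abs_nonpos_iff.1 ((hx j).trans (by linarith))
    have h2 : ‖(x : E4)‖ = 1 := norm_eq_of_mem_sphere x.1
    simp [h1] at h2
  · exact .inr ⟨0, .inr (glueFace_of_eq_q_apply (hneg h))⟩
  · exact .inr ⟨1, .inr (glueFace_of_eq_q_apply (hneg h))⟩
  · exact .inr ⟨2, .inr (glueFace_of_eq_q_apply (hneg h))⟩

/-! ### The sphere is simply connected -/

section Sphere

variable {E : Type*} [NormedAddCommGroup E] [InnerProductSpace ℝ E]

/-- The radial projection of a nonvanishing continuous map to the unit sphere. -/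
def sphereProj {X : Type*} [TopologicalSpace X] (f : C(X, E)) (hf : ∀ x, f x ≠ 0) :
    C(X, Metric.sphere (0 : E) 1) where
  toFun x := ⟨‖f x‖⁻¹ • f x, by
    simp [norm_smul, inv_mul_cancel₀ (norm_ne_zero_iff.2 (hf x))]⟩
  continuous_toFun := by
    refine Continuous.subtype_mk ?_ _
    exact (f.continuous.norm.inv₀ fun x => norm_ne_zero_iff.2 (hf x)).smul f.continuous

lemma sphereProj_apply_of_norm_eq_one {X : Type*} [TopologicalSpace X] (f : C(X, E))
    (hf : ∀ x, f x ≠ 0) {x : X} (hx : ‖f x‖ = 1) : (sphereProj f hf x : E) = f x := by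
  simp [sphereProj, hx]

/-- If the combination vanished, comparing norms would give t = 1/2, hence y = -x. -/
lemma add_smul_ne_zero {x y : E} {t : ℝ} (h0 : 0 ≤ t) (h1 : t ≤ 1) (hx : ‖x‖ = 1)
    (hy : ‖y‖ = 1) (hxy : y ≠ -x) : (1 - t) • x + t • y ≠ 0 := by
  intro h
  have h2 : (1 - t) • x = -(t • y) := eq_neg_of_add_eq_zero_left h
  have h3 := congrArg norm h2
  rw [norm_neg, norm_smul, norm_smul, hx, hy, Real.norm_of_nonneg (by linarith),
    Real.norm_of_nonneg h0] at h3
  have h4 : t = 1 / 2 := by linarith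
  subst h4
  apply hxy
  have h5 : (2 : ℝ) • ((1 - 1 / 2 : ℝ) • x + (1 / 2 : ℝ) • y) = x + y := by
    rw [smul_add, smul_smul, smul_smul]; norm_num
  rw [h, smul_zero] at h5
  exact (neg_eq_of_add_eq_zero_right h5.symm).symm

/-- The complement of a point in the unit sphere is contractible. -/
lemma contractibleSpace_compl_singleton (z : Metric.sphere (0 : E) 1) :
    ContractibleSpace ({z}ᶜ : Set (Metric.sphere (0 : E) 1)) := by
  have hz : ‖(z : E)‖ = 1 := by simp
  have e := (stereographic hz).toHomeomorphSourceTarget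
  rw [stereographic_source, stereographic_target] at e
  exact (e.trans (Homeomorph.Set.univ _)).contractibleSpace

/-- Two paths of the unit sphere with common endpoints that are nowhere antipodal are homotopic. -/
lemma homotopic_of_ne_neg {x y : Metric.sphere (0 : E) 1} (γ δ : Path x y)
    (h : ∀ t, (δ t : E) ≠ -γ t) : γ.Homotopic δ := by
  -- The straight-line homotopy avoids the origin, so it can be projected radially to the sphere.
  let f : C(unitInterval × unitInterval, E) :=
    ⟨fun p => (1 - (p.1 : ℝ)) • (γ p.2 : E) + (p.1 : ℝ) • (δ p.2 : E), by fun_prop⟩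
  have hf (p) : f p ≠ 0 := add_smul_ne_zero p.1.2.1 p.1.2.2 (by simp) (by simp) (h p.2)
  have hf0 (t) : f (0, t) = γ t := by simp [f]
  have hf1 (t) : f (1, t) = δ t := by simp [f]
  refine ⟨⟨⟨sphereProj f hf, fun t => ?_, fun t => ?_⟩, fun s t ht => ?_⟩⟩
  · apply Subtype.ext
    change (sphereProj f hf _ : E) = _
    rw [sphereProj_apply_of_norm_eq_one _ _ (by rw [hf0]; simp), hf0]
    rfl
  · apply Subtype.ext
    change (sphereProj f hf _ : E) = _
    rw [sphereProj_apply_of_norm_eq_one _ _ (by rw [hf1]; simp), hf1]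
    rfl
  · ext1
    have : f (s, t) = γ t := by
      rcases ht with rfl | rfl <;> simp [f, ← add_smul]
    change (sphereProj f hf (s, t) : E) = γ t
    rw [sphereProj_apply_of_norm_eq_one _ _ (by rw [this]; simp), this]

/-- A path of the unit sphere that avoids a point is homotopic to every other such path. -/
lemma homotopic_of_ne (z : Metric.sphere (0 : E) 1) {x y : Metric.sphere (0 : E) 1}
    (γ δ : Path x y) (hγ : ∀ t, γ t ≠ z) (hδ : ∀ t, δ t ≠ z) : γ.Homotopic δ := by
  have := contractibleSpace_compl_singleton z
  let x' : ({z}ᶜ : Set (Metric.sphere (0 : E) 1)) := ⟨x, by simpa using hγ 0⟩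
  let y' : ({z}ᶜ : Set (Metric.sphere (0 : E) 1)) := ⟨y, by simpa using hγ 1⟩
  let γ' : Path x' y' := ⟨⟨fun t => ⟨γ t, hγ t⟩, by fun_prop⟩, by ext1; simp [x'], by ext1; simp [y']⟩
  let δ' : Path x' y' := ⟨⟨fun t => ⟨δ t, hδ t⟩, by fun_prop⟩, by ext1; simp [x'], by ext1; simp [y']⟩
  exact (SimplyConnectedSpace.paths_homotopic γ' δ').map ⟨Subtype.val, by fun_prop⟩

end Sphere

open Polynomial in
/-- Every path of a Euclidean space is uniformly close to a smooth path with the same endpoints. -/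
lemma exists_contDiff_near {n : ℕ} {x y : EuclideanSpace ℝ (Fin n)} (γ : Path x y) {ε : ℝ}
    (hε : 0 < ε) : ∃ f : ℝ → EuclideanSpace ℝ (Fin n), ContDiff ℝ 1 f ∧ f 0 = x ∧ f 1 = y ∧
      ∀ t : unitInterval, ‖f t - γ t‖ < ε := by
  -- The 3 accounts for the approximation errors at t, 0 and 1; the factor n + 1 makes n coordinate
  -- errors sum to a norm below ε, also when n = 0.
  have hδ : 0 < ε / (3 * (n + 1)) := by positivity
  have h (i : Fin n) : ∃ p : ℝ[X], ∀ t : unitInterval,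
      |p.eval (t : ℝ) - γ t i| < ε / (3 * (n + 1)) := by
    obtain ⟨p, hp⟩ := exists_polynomial_near_continuousMap 0 1 ⟨fun t => γ t i, by fun_prop⟩ _ hδ
    exact ⟨p, fun t => (ContinuousMap.norm_lt_iff _ hδ).1 hp t⟩
  choose p hp using h
  -- An affine correction restores the endpoints that the polynomial approximation misses.
  let f : ℝ → EuclideanSpace ℝ (Fin n) := fun t => WithLp.toLp 2 fun i =>
    (p i).eval t + (1 - t) * (x i - (p i).eval 0) + t * (y i - (p i).eval 1)
  refine ⟨f, ?_, ?_, ?_, fun t => ?_⟩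
  · rw [contDiff_euclidean]
    intro i
    have : ContDiff ℝ 1 fun t => (p i).eval t := by simpa using (p i).contDiff_aeval (𝕜 := ℝ) 1
    simp only [f]
    fun_prop
  · ext i; simp [f]
  · ext i; simp [f]
  have hbound (i : Fin n) : |(f t - γ t) i| ≤ ε / (n + 1) := by
    have ht := abs_lt.1 (hp i t)
    have h0 := abs_lt.1 (hp i 0)
    have h1 := abs_lt.1 (hp i 1)
    have h3 : ε / (n + 1) = 3 * (ε / (3 * (n + 1))) := by field_simp
    rw [h3]
    generalize ε / (3 * (n + 1)) = d at *
    obtain ⟨t, ht0, ht1⟩ := t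
    simp [f] at ht h0 h1 ⊢
    rw [abs_le]
    constructor <;> nlinarith
  rw [EuclideanSpace.norm_eq, Real.sqrt_lt' hε]
  calc ∑ i, ‖(f t - γ t) i‖ ^ 2 ≤ ∑ _i : Fin n, (ε / (n + 1)) ^ 2 :=
        Finset.sum_le_sum fun i _ => pow_le_pow_left₀ (norm_nonneg _) (hbound i) 2
    _ = n / (n + 1) ^ 2 * ε ^ 2 := by simp; field_simp
    _ < 1 * ε ^ 2 := by
        gcongr
        rw [div_lt_one (by positivity)]
        nlinarith [(n.cast_nonneg : (0 : ℝ) ≤ n)]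
    _ = ε ^ 2 := one_mul _

/-- Spheres of dimension at least two are simply connected. -/
theorem simplyConnectedSpace_sphere {n : ℕ} (hn : 2 < n) :
    SimplyConnectedSpace (Metric.sphere (0 : EuclideanSpace ℝ (Fin n)) 1) := by
  have hrank : 1 < Module.rank ℝ (EuclideanSpace ℝ (Fin n)) := by
    rw [← Module.finrank_eq_rank]
    simp
    omega
  rw [simply_connected_iff_loops_nullhomotopic]
  refine ⟨isPathConnected_iff_pathConnectedSpace.1 (isPathConnected_sphere hrank 0 zero_le_one),
    fun x γ => ?_⟩
  -- Staying within distance 1 of a unit vector excludes both the origin and the opposite ray.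
  obtain ⟨f, hf, hf0, hf1, hfγ⟩ := exists_contDiff_near (γ.map continuous_subtype_val) one_pos
  have hne (t : unitInterval) : f t ≠ 0 := by
    intro h
    have := hfγ t
    simp [h] at this
  let F : C(unitInterval, EuclideanSpace ℝ (Fin n)) :=
    ⟨fun t => f t, hf.continuous.comp continuous_subtype_val⟩
  let δ : Path x x := ⟨sphereProj F hne, by
      apply Subtype.ext
      change (sphereProj F hne _ : EuclideanSpace ℝ (Fin n)) = _
      rw [sphereProj_apply_of_norm_eq_one] <;> simp [F, hf0], by
      apply Subtype.ext
      change (sphereProj F hne _ : EuclideanSpace ℝ (Fin n)) = _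
      rw [sphereProj_apply_of_norm_eq_one] <;> simp [F, hf1]⟩
  have hδ (t : unitInterval) : (δ t : EuclideanSpace ℝ (Fin n)) = ‖f t‖⁻¹ • f t := rfl
  have h1 : γ.Homotopic δ := by
    refine homotopic_of_ne_neg γ δ fun t ht => ?_
    have h2 : f t = -(‖f t‖ • (γ t : EuclideanSpace ℝ (Fin n))) := by
      rw [← smul_neg, ← ht, hδ, smul_smul, mul_inv_cancel₀ (norm_ne_zero_iff.2 (hne t)), one_smul]
    have h3 := hfγ t
    have h4 : f t - (γ t : EuclideanSpace ℝ (Fin n)) = -((‖f t‖ + 1) • γ t) := by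
      nth_rw 1 [h2]
      module
    rw [Path.map_coe, Function.comp_apply, h4, norm_neg, norm_smul, norm_eq_of_mem_sphere,
      mul_one, Real.norm_of_nonneg (by positivity)] at h3
    linarith [norm_nonneg (f t)]
  obtain ⟨z, hz⟩ : ∃ z, ∀ t, δ t ≠ z := by
    -- The cone over the C¹ curve is a C¹ image of a plane, so in dimension n > 2 it misses some w.
    -- As a full cone it then misses the whole line through w, so the projected loop avoids w/‖w‖.
    let g : ℝ × ℝ → EuclideanSpace ℝ (Fin n) := fun p => p.1 • f p.2
    have hg : ContDiff ℝ 1 g := contDiff_fst.smul (hf.comp contDiff_snd)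
    obtain ⟨w, hw⟩ := (hg.dense_compl_range_of_finrank_lt_finrank (by simpa using hn)).nonempty
    have hw0 : w ≠ 0 := fun h => hw ⟨(0, 0), by simp [g, h]⟩
    refine ⟨⟨‖w‖⁻¹ • w, by simp [norm_smul, inv_mul_cancel₀ (norm_ne_zero_iff.2 hw0)]⟩,
      fun t ht => hw ⟨(‖w‖ * ‖f t‖⁻¹, t), ?_⟩⟩
    have h5 : ‖f t‖⁻¹ • f t = ‖w‖⁻¹ • w := (hδ t).symm.trans (congrArg Subtype.val ht)
    simp only [g]
    rw [mul_smul, h5, smul_smul, mul_inv_cancel₀ (norm_ne_zero_iff.2 hw0), one_smul]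
  refine h1.trans (homotopic_of_ne z δ (Path.refl x) hz fun t => ?_)
  simpa using hz 0

/-! ### The universal covering -/

instance : MulAction Q S3 where
  smul g x := act g x
  one_smul _ := rfl
  mul_smul _ _ _ := rfl

instance : ContinuousConstSMul Q S3 := ⟨fun g => (act g).continuous⟩

instance : Finite Q := Finite.of_equiv _ quaternionEquivQ.toEquiv

lemma act_ne_self {g : O4} (hg : g ∈ Q) (h1 : g ≠ 1) (x : S3) : act g x ≠ x := fun h =>
  h1 (eq_one_of_apply_eq hg (ne_zero_of_mem_unit_sphere x) (congrArg Subtype.val h))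

instance : IsCancelSMul Q S3 :=
  isCancelSMul_iff_eq_one_of_smul_eq.2 fun g x h => by
    by_contra hg
    exact act_ne_self g.2 (fun h1 => hg (Subtype.ext h1)) x h

/-- The map from `C3` to the orbit space of `Q`. -/
def toOrbits : C3 → MulAction.orbitRel.Quotient Q S3 :=
  Quot.lift (fun x => Quotient.mk _ (x : S3)) <| by
    rintro x y ⟨j, h⟩
    refine (Quotient.sound (s := MulAction.orbitRel Q S3) ?_).symm
    exact ⟨⟨q j, q_mem_Q j⟩, Subtype.ext ((glueFace_iff j x y).1 h).2.symm⟩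

lemma continuous_toOrbits : Continuous toOrbits :=
  continuous_quot_lift _ (continuous_quotient_mk'.comp continuous_subtype_val)

/-- Injectivity says that the gluings already account for all identifications by `Q` inside the
cube; surjectivity is the covering of the sphere by the cells. -/
lemma toOrbits_bijective : Function.Bijective toOrbits := by
  constructor
  · rintro ⟨x⟩ ⟨y⟩ h
    obtain ⟨g, hg⟩ := Quotient.exact (s := MulAction.orbitRel Q S3) h.symm
    have h1 : (y : E4) = (g : O4) x := congrArg Subtype.val hg.symm
    rcases eq_or_glueFace_of_act_eq g.2 h1 with rfl | ⟨j, h | h⟩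
    · rfl
    · exact Quot.sound ⟨j, h⟩
    · exact (Quot.sound ⟨j, h⟩).symm
  · intro c
    induction c using Quotient.inductionOn with
    | h x =>
      obtain ⟨g, hg, hx⟩ := exists_act_mem_cube x
      exact ⟨C3.mk ⟨_, hx⟩, Quotient.sound (s := MulAction.orbitRel Q S3) ⟨⟨g, hg⟩, rfl⟩⟩

lemma isClosed_cell (c : E4) : IsClosed (cell c) := by
  simp only [cell, Set.ofPred_forall]
  exact isClosed_iInter fun j => isClosed_le (by fun_prop) (by fun_prop)

instance : CompactSpace cube := isCompact_iff_compactSpace.1 (isClosed_cell _).isCompact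

/-- `C3` is homeomorphic to the orbit space of `Q`. -/
def homeoOrbits : C3 ≃ₜ MulAction.orbitRel.Quotient Q S3 :=
  Continuous.homeoOfEquivCompactToT2 (f := Equiv.ofBijective _ toOrbits_bijective)
    continuous_toOrbits

/-- The universal covering of `C3`. -/
def covering : S3 → C3 := homeoOrbits.symm ∘ Quotient.mk (MulAction.orbitRel Q S3)

lemma isQuotientCoveringMap_covering : IsQuotientCoveringMap covering Q :=
  (isQuotientCoveringMap_quotientMk_of_properlyDiscontinuousSMul
    (G := Q) (E := S3)).homeomorph_comp _

lemma covering_coe (x : cube) : covering x = C3.mk x :=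
  homeoOrbits.symm_apply_eq.2 rfl

lemma simplyConnectedSpace_S3 : SimplyConnectedSpace S3 := simplyConnectedSpace_sphere (by norm_num)

lemma act_injective : Function.Injective act := by
  intro g h hgh
  ext1 x
  rcases eq_or_ne x 0 with rfl | hx
  · rw [map_zero, map_zero]
  have hx' := norm_ne_zero_iff.2 hx
  have h1 : g (‖x‖⁻¹ • x) = h (‖x‖⁻¹ • x) :=
    congrArg (fun f : S3 ≃ₜ S3 => (f ⟨‖x‖⁻¹ • x, by simp [norm_smul, hx']⟩ : E4)) hgh
  rw [map_smul, map_smul] at h1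
  exact smul_right_injective E4 (inv_ne_zero hx') h1

/-- The deck transformations of the universal covering are the elements of `Q`. -/
lemma deck_covering : deck covering = Q.map act := by
  have := simplyConnectedSpace_S3
  have hq := isQuotientCoveringMap_covering
  ext f
  constructor
  · intro hf
    obtain ⟨x₀⟩ : Nonempty S3 := inferInstance
    obtain ⟨g, hg⟩ := hq.apply_eq_iff_mem_orbit.1 (hf x₀)
    refine ⟨g, g.2, ?_⟩
    ext1 x
    -- f and g are two lifts of the covering map that agree at `x₀`, so they coincide on the
    -- connected sphere.
    refine congrFun (hq.isCoveringMap.eq_of_comp_eq (act g).continuous f.continuous ?_ x₀ hg) x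
    ext1 y
    exact (hq.map_smul g).trans (hf y).symm
  · rintro ⟨g, hg, rfl⟩ x
    exact hq.map_smul (⟨g, hg⟩ : Q)

/-- The deck group is isomorphic to `Q`. -/
def deckEquiv : Q ≃* deck covering :=
  ((Q.equivMapOfInjective act act_injective)).trans (MulEquiv.subgroupCongr deck_covering.symm)

lemma nonempty_fundamentalGroup_equiv (c : C3) :
    Nonempty (FundamentalGroup C3 c ≃* QuaternionGroup 2) := by
  have := simplyConnectedSpace_S3
  have hq := isQuotientCoveringMap_covering
  obtain ⟨e, he⟩ := hq.surjective c
  -- The fundamental group is identified with the opposite group of `Q`; inversion turns this into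
  -- `Q`.
  exact ⟨(hq.fundamentalGroupEquiv (e := ⟨e, he⟩)).trans
    ((MulEquiv.inv' Q).symm.trans quaternionEquivQ.symm)⟩

end CubicSpherical
end

open CubicSpherical
theorem mainTheorem2 :
    -- the fundamental group of `C3`, at every base point, is the quaternion group
    (∀ c : C3, Nonempty (FundamentalGroup C3 c ≃* QuaternionGroup 2)) ∧
    -- `S³` is the universal covering of `C3`, the covering map extends the projection from the
    -- cubic prototile, and its deck group is the group `Q`, a quaternion group acting on `S³`
    SimplyConnectedSpace S3 ∧
    (∃ p : S3 → C3, IsCoveringMap p ∧ Function.Surjective p ∧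
      (∀ x : cube, p x = C3.mk x) ∧
      deck p = Q.map act ∧
      Nonempty (deck p ≃* QuaternionGroup 2)) ∧
    Nonempty (Q ≃* QuaternionGroup 2) ∧
    -- the generators realize the gluings of the faces
    (∀ (j : Fin 3) (x y : cube),
      GlueFace j x y ↔ (x : E4) j.succ = -(x : E4) 0 ∧ (y : E4) = q j x) ∧
    (∀ (j : Fin 3) (x : cube), (x : E4) j.succ = -(x : E4) 0 → act (q j) x ∈ cube) ∧
    -- relations, and the list of elements
    (q1 ^ 2 = J4 ∧ q2 ^ 2 = J4 ∧ q3 ^ 2 = J4 ∧ q1 * q2 * q3 = J4) ∧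
    (Q : Set O4) = {1, q1, q2, q3, J4, J4 * q1, J4 * q2, J4 * q3} ∧
    -- the action is by left multiplication with elements of `SU(2)`
    (q1 = W 2 * W 1 * W 0 * W 4 ∧
      ActsAs q1 (v 2 * (v 1)⁻¹ * v 0 * (v 4)⁻¹) ((v 2)⁻¹ * v 1 * (v 0)⁻¹ * v 4)) ∧
    (∀ j : Fin 3, wLeft j ∈ Matrix.specialUnitaryGroup (Fin 2) ℂ ∧ ActsAs (q j) (wLeft j) 1) ∧
    (∃ φ : Q →* Matrix.specialUnitaryGroup (Fin 2) ℂ, Function.Injective φ ∧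
      ∀ (g : Q) (x : E4),
        u ((g : O4) x) = (φ g : Matrix (Fin 2) (Fin 2) ℂ) * u x) ∧
    -- the action is free of fixed points
    (∀ g ∈ Q, g ≠ 1 → ∀ x : S3, act g x ≠ x) ∧
    -- the images of the cubic prototile are the cubes of the 8-cell, each occurring once,
    -- and they tile `S³`
    Set.BijOn (fun g : O4 => act g '' cube) Q eightCell ∧
    (⋃ g ∈ Q, act g '' cube) = Set.univ ∧
    (∀ g ∈ Q, ∀ h ∈ Q, g ≠ h →
      Disjoint (interior (act g '' cube)) (interior (act h '' cube))) ∧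
    -- the chain of groups `O(4,ℝ) > G > Q`
    Q < G ∧ G < (⊤ : Subgroup O4) := by

  refine ⟨nonempty_fundamentalGroup_equiv, simplyConnectedSpace_S3,
    ⟨covering, isQuotientCoveringMap_covering.isCoveringMap,
      isQuotientCoveringMap_covering.surjective, covering_coe, deck_covering,
      ⟨deckEquiv.symm.trans quaternionEquivQ.symm⟩⟩, ⟨quaternionEquivQ.symm⟩,
    glueFace_iff, act_q_mem_cube, ⟨q1_sq, q2_sq, q3_sq, q1_mul_q2_mul_q3⟩, coe_Q,
    ⟨q1_eq_W, actsAs_q1⟩, fun j => ⟨wLeft_mem_specialUnitaryGroup j, actsAs_q j⟩,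
    ⟨toSU, toSU_injective, fun g x => u_apply_of_mem_Q g.2 x⟩,
    fun g hg h1 x => act_ne_self hg h1 x, bijOn_act_image_cube, iUnion_act_image_cube,
    fun g hg h hh hgh => ?_, Q_lt_G, G_lt_top⟩
  rw [act_image_cube hg, act_image_cube hh]
  exact disjoint_interior_cell (image_Q_single_zero ▸ Set.mem_image_of_mem _ hg)
    (image_Q_single_zero ▸ Set.mem_image_of_mem _ hh) fun h1 => hgh (eq_of_mem_Q hg hh h1)
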